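/- Let $\mathcal I=\mathsf{fin}\times\mathsf{fin}$ be the ideal on $\omega\times\omega$ consisting of all sets $A$ such that for all but finitely many $n$ the section $\{m:(n,m)\in A\}$ is finite, and let $\mathcal I^+$ be the family of subsets of $\omega\times\omega$ that are not in $\mathcal I$. Let $\mathbb L(\mathcal I^+)$ be the associated Laver forcing: its conditions are the trees $T\subseteq(\omega\times\omega)^{<\omega}$ (sets of finite sequences closed under initial segments) that have a stem $s\in T$ such that every node of $T$ is comparable with $s$ and, for every $\tau\in T$ extending $s$, the set $\mathrm{succ}_T(\tau)=\{a\in\omega\times\omega:\tau^\frown a\in T\}$ belongs to $\mathcal I^+$; the order is inclusion, that is, $S\le T$ if $S\subseteq T$. For a tree $T$ let $[T]=\{x\in(\omega\times\omega)^{\omega}:\forall n\ (x\upharpoonright n\in T)\}$ be its set of branches, with the topology inherited from the product $(\omega\times\omega)^{\omega}$ of discrete spaces. Theorem. $\mathbb L(\mathcal I^+)$ has the one-to-one or constant property: for every $T\in\mathbb L(\mathcal I^+)$ and every Borel function $f:[T]\to 2^\omega$ there is $S\in\mathbb L(\mathcal I^+)$ with $S\le T$ such that $f\upharpoonright[S]$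 is injective or constant. -/

import Mathlib

namespace LaverCoideal

open Descriptive

/-- The ideal `fin × fin` on `ω × ω`: the sets `A` such that for all but finitely many `n`
the vertical section `{m | (n, m) ∈ A}` is finite. -/
def finTimesFin : Order.Ideal (Set (ℕ × ℕ)) where
  carrier := {A | {n : ℕ | ¬ {m : ℕ | (n, m) ∈ A}.Finite}.Finite}
  lower' := by
    intro A B hBA hA
    refine Set.Finite.subset hA ?_
    intro n hn hfin
    exact hn (hfin.subset fun m hm => hBA hm)
  nonempty' := ⟨∅, by simp⟩
  directed' := by
    intro A hA B hB
    refine ⟨A ∪ B, ?_, Set.subset_union_left, Set.subset_union_right⟩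
    refine Set.Finite.subset (Set.Finite.union hA hB) ?_
    intro n hn
    by_contra h
    simp only [Set.mem_union, Set.mem_ofPred_eq, not_or, not_not] at h
    exact hn ((h.1.union h.2).subset fun m hm => hm)

/-- The family of `I`-positive sets, i.e. of the subsets of `A` that are not in `I`. -/
def positive {A : Type*} (I : Order.Ideal (Set A)) : Set (Set A) :=
  {X | X ∉ I}

/-- The set `succ_T(τ)` of the one-point extensions of `τ` in `T`. -/
def succ {A : Type*} (T : tree A) (τ : List A) : Set A :=
  {a | τ ++ [a] ∈ T}

/-- `s` is a stem of `T` all of whose extensions in `T` have an `I`-positive set of successors: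
`s` is a node of `T`, every node of `T` is comparable with `s`, and `succ_T(τ)` is `I`-positive
for every node `τ` of `T` that extends `s`. -/
structure IsLaverStem {A : Type*} (I : Order.Ideal (Set A)) (T : tree A) (s : List A) :
    Prop where
  mem : s ∈ T
  comparable : ∀ τ ∈ T, τ <+: s ∨ s <+: τ
  succ_positive : ∀ τ ∈ T, s <+: τ → succ T τ ∈ positive I

/-- The conditions of the Laver forcing `𝕃(I⁺)` associated with the co-ideal `I⁺`.
The forcing is ordered by inclusion of trees, which is the order of `tree A`. -/
def laver {A : Type*} (I : Order.Ideal (Set A)) : Set (tree A) :=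
  {T | ∃ s, IsLaverStem I T s}

/-- The set `[T]` of the infinite branches of `T`. -/
def branches {A : Type*} (T : tree A) : Set (ℕ → A) :=
  {x | ∀ n : ℕ, (List.range n).map x ∈ T}

/-- `𝕃(I⁺)` has the one-to-one or constant property: for every condition `T` and every Borel
function `f : [T] → 2^ω` there is a condition `S ≤ T` such that the restriction of `f` to `[S]`
is injective or constant. The set `A` carries the discrete topology, `ℕ → A` and `ℕ → Bool` carry
the product topologies and `[T]` the subspace topology. -/
def OneToOneOrConstant {A : Type*} [TopologicalSpace A] [DiscreteTopology A]
    (I : Order.Ideal (Set A)) : Prop :=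
  ∀ T ∈ laver I, ∀ f : branches T → (ℕ → Bool),
    @Measurable _ _ (borel (branches T)) (borel (ℕ → Bool)) f →
    ∃ S ∈ laver I, S ≤ T ∧
      (Set.InjOn f {x | (x : ℕ → A) ∈ branches S} ∨
        ∃ c : ℕ → Bool, ∀ x : branches T, (x : ℕ → A) ∈ branches S → f x = c)

end LaverCoideal

/-! A positive set for `fin × fin` contains infinitely many columns, each with infinitely many
chosen points, so choosing a successor amounts to two Laver choices in `ω`: a column, then a point
in it. Hence `code` maps `ω^ω` continuously and injectively into `[T]`, and carries Laver trees with
stems of even length to conditions below `T`. It suffices to treat Laver forcing on `ω`.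

There, Borel sets are decided without changing the stem. By fusion and compactness every node `σ`
gets a limit `x σ` in `2^ω`, to which the values of `F` beyond `σ ++ [a]` converge as `a` grows.
Call `σ` splitting (`P σ`) if only finitely many successors keep its limit. If some Laver tree
avoids splitting nodes, the limit is constant along it and `F` is constant. Otherwise a rank forces
every branch to meet splitting nodes again and again, with the limit unchanged up to the next one.
Thin the tree so that a splitting node and its successor are determined by the first level at which
their limits differ (`exists_thinning_injective`), and so that later choices do not disturb the
values up to that level. Then `F y` reveals which way `y` left the first splitting node after any
given position, so `F` is injective. -/

namespace LaverCoideal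

open Descriptive Filter Topology

/-! ### Finite and infinite sequences -/

section Sequences

variable {A : Type*}

/-- The initial segment of length `n` of an infinite sequence. -/
def initSeg (y : ℕ → A) (n : ℕ) : List A := (List.range n).map y

@[simp] lemma length_initSeg (y : ℕ → A) (n : ℕ) : (initSeg y n).length = n := by
  simp [initSeg]

@[simp] lemma initSeg_zero (y : ℕ → A) : initSeg y 0 = [] := rfl

lemma initSeg_succ (y : ℕ → A) (n : ℕ) : initSeg y (n + 1) = initSeg y n ++ [y n] := by
  simp [initSeg, List.range_succ]

lemma initSeg_eq_iff {y z : ℕ → A} {n : ℕ} :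
    initSeg y n = initSeg z n ↔ ∀ k < n, y k = z k := by
  simp [initSeg]

lemma initSeg_eq_of_le {y z : ℕ → A} {m n : ℕ} (h : initSeg y n = initSeg z n) (hmn : m ≤ n) :
    initSeg y m = initSeg z m :=
  initSeg_eq_iff.2 fun k hk => initSeg_eq_iff.1 h k (hk.trans_le hmn)

lemma getD_initSeg (y : ℕ → A) {k n : ℕ} (h : k < n) (d : A) : (initSeg y n).getD k d = y k := by
  simp [initSeg, List.getD, h]

lemma initSeg_prefix (y : ℕ → A) {m n : ℕ} (h : m ≤ n) : initSeg y m <+: initSeg y n := by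
  induction n, h using Nat.le_induction with
  | base => exact List.prefix_refl _
  | succ n _ ih => exact ih.trans (by rw [initSeg_succ]; exact List.prefix_append _ _)

lemma initSeg_of_prefix {y : ℕ → A} {σ : List A} {n : ℕ} (h : σ <+: initSeg y n) :
    initSeg y σ.length = σ := by
  have hl : σ.length ≤ n := by simpa using h.length_le
  exact (List.prefix_of_prefix_length_le (initSeg_prefix y hl) h (by simp)).eq_of_length (by simp)

lemma initSeg_length_append {y : ℕ → A} {σ : List A} {a : A} :
    initSeg y (σ ++ [a]).length = σ ++ [a] ↔ initSeg y σ.length = σ ∧ y σ.length = a := by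
  simp only [List.length_append, List.length_singleton, initSeg_succ]
  constructor
  · intro h
    have := List.append_inj h (by simp)
    simpa using this
  · rintro ⟨h, h'⟩
    rw [h, h']

/-- The finite approximations of the sequence whose next value is computed by `c` from the
previous ones. -/
def branchAux (c : List A → A) : ℕ → List A
  | 0 => []
  | n + 1 => branchAux c n ++ [c (branchAux c n)]

/-- The sequence whose next value is computed by `c` from the previous ones. -/
def branch (c : List A → A) (n : ℕ) : A := c (branchAux c n)

lemma initSeg_branch (c : List A → A) (n : ℕ) : initSeg (branch c) n = branchAux c n := by
  induction n with
  | zero => rfl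
  | succ n ih => rw [initSeg_succ, ih]; rfl

lemma branch_eq (c : List A → A) (n : ℕ) : branch c n = c (initSeg (branch c) n) := by
  rw [initSeg_branch]; rfl

/-- The sequence that starts with `σ` and whose later values are computed by `c` from the
previous ones. -/
def branchFrom (σ : List A) (c : List A → A) : ℕ → A :=
  branch fun τ => σ.getD τ.length (c τ)

lemma initSeg_branchFrom (σ : List A) (c : List A → A) :
    initSeg (branchFrom σ c) σ.length = σ := by
  refine List.ext_getElem (by simp) fun n h₁ h₂ => ?_
  have : (initSeg (branchFrom σ c) σ.length)[n] = branchFrom σ c n := by simp [initSeg]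
  rw [this, branchFrom, branch_eq]
  simp [h₂]

lemma branchFrom_eq (σ : List A) (c : List A → A) {n : ℕ} (h : σ.length ≤ n) :
    branchFrom σ c n = c (initSeg (branchFrom σ c) n) := by
  conv_lhs => rw [branchFrom, branch_eq]
  rw [List.getD_eq_default _ _ (by simpa using h)]
  rfl

end Sequences

/-! ### Laver trees on `ω`: gluing and fusion -/

/-- A choice of an infinite set of immediate successors for every finite sequence of natural
numbers, which represents the Laver trees that it generates. -/
abbrev Thinning := {C : List ℕ → Set ℕ // ∀ τ, (C τ).Infinite}

/-- The branches of the Laver tree with stem `σ` generated by `C`. -/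
def cone (C : Thinning) (σ : List ℕ) : Set (ℕ → ℕ) :=
  {y | initSeg y σ.length = σ ∧ ∀ n, σ.length ≤ n → y n ∈ C.1 (initSeg y n)}

lemma cone_subset {C D : Thinning} {σ : List ℕ} (h : ∀ τ, σ <+: τ → C.1 τ ⊆ D.1 τ) :
    cone C σ ⊆ cone D σ := by
  rintro y ⟨h₁, h₂⟩
  refine ⟨h₁, fun n hn => h _ ?_ (h₂ n hn)⟩
  conv_lhs => rw [← h₁]
  exact initSeg_prefix y hn

lemma cone_mono {C D : Thinning} (h : C ≤ D) (σ : List ℕ) : cone C σ ⊆ cone D σ :=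
  cone_subset fun τ _ => h τ

lemma mem_cone_initSeg {C : Thinning} {σ : List ℕ} {y : ℕ → ℕ} (hy : y ∈ cone C σ) {n : ℕ}
    (hn : σ.length ≤ n) : y ∈ cone C (initSeg y n) :=
  ⟨by simp, fun m hm => hy.2 m (hn.trans (by simpa using hm))⟩

lemma cone_initSeg_subset {C : Thinning} {σ : List ℕ} {y : ℕ → ℕ} (hy : y ∈ cone C σ) {n : ℕ}
    (hn : σ.length ≤ n) : cone C (initSeg y n) ⊆ cone C σ := by
  rintro z ⟨h₁, h₂⟩
  rw [length_initSeg] at h₁ h₂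
  refine ⟨by rw [initSeg_eq_of_le h₁ hn, hy.1], fun m hm => ?_⟩
  rcases lt_or_ge m n with h | h
  · rw [initSeg_eq_of_le h₁ h.le, initSeg_eq_iff.1 h₁ m h]
    exact hy.2 m hm
  · exact h₂ m h

lemma cone_append_subset {C : Thinning} {σ : List ℕ} {a : ℕ} (ha : a ∈ C.1 σ) :
    cone C (σ ++ [a]) ⊆ cone C σ := by
  rintro y ⟨h₁, h₂⟩
  rw [initSeg_length_append] at h₁
  refine ⟨h₁.1, fun n hn => ?_⟩
  rcases hn.eq_or_lt with rfl | hn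
  · rw [h₁.1, h₁.2]; exact ha
  · exact h₂ n (by simpa using hn)

lemma cone_nonempty (C : Thinning) (σ : List ℕ) : (cone C σ).Nonempty := by
  choose c hc using fun τ => (C.2 τ).nonempty
  refine ⟨branchFrom σ c, initSeg_branchFrom σ c, fun n hn => ?_⟩
  rw [branchFrom_eq σ c hn]
  exact hc _

/-- Laver trees with the same stem can be glued over an infinite set of one-point extensions. -/
lemma exists_cone_subset {C : Thinning} {σ : List ℕ} {X : Set (ℕ → ℕ)}
    (h : {a ∈ C.1 σ | ∃ D ≤ C, cone D (σ ++ [a]) ⊆ X}.Infinite) :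
    ∃ D ≤ C, cone D σ ⊆ X := by
  classical
  set A := {a ∈ C.1 σ | ∃ D ≤ C, cone D (σ ++ [a]) ⊆ X} with hA
  have : ∀ a, ∃ D ≤ C, a ∈ A → cone D (σ ++ [a]) ⊆ X := by
    intro a
    by_cases ha : a ∈ A
    · obtain ⟨D, hD, hX⟩ := ha.2
      exact ⟨D, hD, fun _ => hX⟩
    · exact ⟨C, le_rfl, fun h => absurd h ha⟩
  choose D hDC hD using this
  -- Beyond `σ`, the entry at position `σ.length` tells which `D a` to follow; the default `0` is
  -- never read there.
  refine ⟨⟨fun τ => if τ = σ then A else (D (τ.getD σ.length 0)).1 τ, fun τ => ?_⟩, ?_, ?_⟩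
  · dsimp only
    split_ifs
    exacts [h, (D _).2 τ]
  · intro τ
    dsimp only
    split_ifs with hτ
    · subst hτ
      exact fun a ha => ha.1
    · exact hDC _ τ
  · rintro y ⟨h₁, h₂⟩
    have ha : y σ.length ∈ A := by simpa [h₁] using h₂ _ le_rfl
    refine hD _ ha ⟨initSeg_length_append.2 ⟨h₁, rfl⟩, fun n hn => ?_⟩
    have hn' : σ.length < n := by simpa using hn
    have := h₂ n hn'.le
    dsimp only at this
    rw [if_neg, getD_initSeg y hn'] at this
    · exact this
    · intro h
      simpa [hn'.ne'] using congrArg List.length h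

/-- Fusion: if every condition can be shrunk, without changing its stem `σ`, to one with the
property `Q σ`, then this can be done at all nodes at the same time. -/
lemma exists_fusion (D : Thinning) (Q : List ℕ → Thinning → Prop)
    (h : ∀ σ, ∀ C ≤ D, ∃ C' ≤ C, Q σ C') :
    ∃ E ≤ D, ∀ σ, ∃ G ≤ D, Q σ G ∧ cone E σ ⊆ cone G σ := by
  have : ∀ σ C, ∃ C' ≤ C, C ≤ D → Q σ C' := by
    intro σ C
    by_cases hC : C ≤ D
    · obtain ⟨C', h₁, h₂⟩ := h σ C hC
      exact ⟨C', h₁, fun _ => h₂⟩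
    · exact ⟨C, le_rfl, fun h => absurd h hC⟩
  choose shr hle hQ using this
  -- `G' σ` results from shrinking `D` successively for the proper initial segments of `σ`, and `G
  -- σ` shrinks once more for `σ`. So `G` decreases along extensions, and the diagonal choice `(G
  -- σ).1 σ` is the fusion.
  let G : List ℕ → Thinning := fun σ =>
    shr σ (Nat.rec D (fun n C => shr (σ.take n) C) σ.length)
  let G' : List ℕ → Thinning := fun σ => Nat.rec D (fun n C => shr (σ.take n) C) σ.length
  have hG : ∀ σ, G σ = shr σ (G' σ) := fun _ => rfl
  have hG' : ∀ σ a, G' (σ ++ [a]) = G σ := by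
    intro σ a
    have key : ∀ n ≤ σ.length,
        (Nat.rec D (fun n C => shr ((σ ++ [a]).take n) C) n : Thinning) =
          Nat.rec D (fun n C => shr (σ.take n) C) n := by
      intro n hn
      induction n with
      | zero => rfl
      | succ n ih =>
        dsimp only
        rw [ih (by omega), List.take_append_of_le_length (by omega)]
    have h1 := key σ.length le_rfl
    have h2 : G' (σ ++ [a]) = Nat.rec D (fun n C => shr ((σ ++ [a]).take n) C) (σ.length + 1) := by
      simp only [G', List.length_append, List.length_singleton]
    rw [h2]
    dsimp only
    rw [h1, List.take_left']
    rfl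
  have hstep : ∀ σ a, G (σ ++ [a]) ≤ G σ := fun σ a => by
    rw [hG, hG']; exact hle _ _
  have hD' : ∀ σ, G' σ ≤ D := by
    intro σ
    induction σ using List.reverseRecOn with
    | nil => exact le_rfl
    | append_singleton σ a ih => rw [hG', hG]; exact (hle _ _).trans ih
  have hanti : ∀ σ τ, σ <+: τ → G τ ≤ G σ := by
    rintro σ _ ⟨ρ, rfl⟩
    induction ρ using List.reverseRecOn with
    | nil => simp
    | append_singleton ρ a ih => rw [← List.append_assoc]; exact (hstep _ _).trans ih
  refine ⟨⟨fun σ => (G σ).1 σ, fun σ => (G σ).2 σ⟩, fun σ => ((hle _ _).trans (hD' σ)) σ,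
    fun σ => ⟨G σ, (hle _ _).trans (hD' σ), hQ _ _ (hD' σ), cone_subset fun τ hτ => hanti σ τ hτ τ⟩⟩

/-! ### Pure decision for Borel sets -/

/-- Every condition of Laver forcing has an extension with the same stem whose branches
are all in `B` or all outside `B`. -/
def PureDecision (B : Set (ℕ → ℕ)) : Prop :=
  ∀ σ (C : Thinning), ∃ D ≤ C, cone D σ ⊆ B ∨ cone D σ ⊆ Bᶜ

lemma PureDecision.compl {B : Set (ℕ → ℕ)} (h : PureDecision B) : PureDecision Bᶜ := by
  intro σ C
  obtain ⟨D, hD, h | h⟩ := h σ C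
  · exact ⟨D, hD, Or.inr (by rwa [compl_compl])⟩
  · exact ⟨D, hD, Or.inl h⟩

/-- An undecidable stem has infinitely many undecidable one-point extensions, by gluing, which gives
a tree of undecidable nodes. Such a node cannot be shrunk into any `B n`, so it can be shrunk out of
it. Fusing, with `B n` treated `n` levels above the stem, avoids the whole union and so decides it
after all. -/
lemma PureDecision.iUnion {B : ℕ → Set (ℕ → ℕ)} (h : ∀ n, PureDecision (B n)) :
    PureDecision (⋃ n, B n) := by
  classical
  intro σ₀ C
  by_contra hbad₀
  set U := ⋃ n, B n with hU
  let bad : List ℕ → Prop := fun σ => ¬ ∃ D ≤ C, cone D σ ⊆ U ∨ cone D σ ⊆ Uᶜ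
  have hinf : ∀ σ, bad σ → {a ∈ C.1 σ | bad (σ ++ [a])}.Infinite := by
    intro σ hσ hfin
    have hcover : C.1 σ ⊆ {a ∈ C.1 σ | bad (σ ++ [a])} ∪
        ({a ∈ C.1 σ | ∃ D ≤ C, cone D (σ ++ [a]) ⊆ U} ∪
          {a ∈ C.1 σ | ∃ D ≤ C, cone D (σ ++ [a]) ⊆ Uᶜ}) := by
      intro a ha
      by_cases hb : bad (σ ++ [a])
      · exact Or.inl ⟨ha, hb⟩
      · obtain ⟨D, hD, h | h⟩ := not_not.1 hb
        · exact Or.inr (Or.inl ⟨ha, D, hD, h⟩)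
        · exact Or.inr (Or.inr ⟨ha, D, hD, h⟩)
    rcases Set.infinite_union.1 ((C.2 σ).mono hcover) with h | h
    · exact h hfin
    rcases Set.infinite_union.1 h with h | h
    · obtain ⟨D, hD, h⟩ := exists_cone_subset h
      exact hσ ⟨D, hD, Or.inl h⟩
    · obtain ⟨D, hD, h⟩ := exists_cone_subset h
      exact hσ ⟨D, hD, Or.inr h⟩
  let D : Thinning := ⟨fun σ => if bad σ then {a ∈ C.1 σ | bad (σ ++ [a])} else C.1 σ, by
    intro σ
    dsimp only
    split_ifs with hσ
    exacts [hinf σ hσ, C.2 σ]⟩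
  have hDC : D ≤ C := by
    intro σ
    dsimp only [D]
    split_ifs
    exacts [fun a ha => ha.1, le_rfl]
  have hbad : ∀ y ∈ cone D σ₀, ∀ n, bad (initSeg y (σ₀.length + n)) := by
    rintro y ⟨h₁, h₂⟩ n
    induction n with
    | zero => rw [add_zero, h₁]; exact hbad₀
    | succ n ih =>
      have := h₂ (σ₀.length + n) (by omega)
      simp only [D, if_pos ih] at this
      rw [← add_assoc, initSeg_succ]
      exact this.2
  obtain ⟨E, hED, hE⟩ := exists_fusion D
    (fun σ G => bad σ → cone G σ ⊆ (B (σ.length - σ₀.length))ᶜ) (by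
      intro σ G hG
      obtain ⟨G', hG', h | h⟩ := h (σ.length - σ₀.length) σ G
      · exact ⟨G', hG', fun hb => absurd
          ⟨G', hG'.trans (hG.trans hDC), Or.inl (h.trans (Set.subset_iUnion B _))⟩ hb⟩
      · exact ⟨G', hG', fun _ => h⟩)
  refine hbad₀ ⟨E, hED.trans hDC, Or.inr fun y hy hyU => ?_⟩
  obtain ⟨n, hn⟩ := Set.mem_iUnion.1 hyU
  obtain ⟨G, -, hG, hEG⟩ := hE (initSeg y (σ₀.length + n))
  have := hG (hbad y (cone_mono hED _ hy) n) (hEG (mem_cone_initSeg hy (by omega)))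
  rw [length_initSeg, Nat.add_sub_cancel_left] at this
  exact this hn

lemma pureDecision_eval (n k : ℕ) : PureDecision {y | y n = k} := by
  intro σ C
  rcases lt_or_ge n σ.length with hn | hn
  · refine ⟨C, le_rfl, ?_⟩
    have : ∀ y ∈ cone C σ, y n = σ.getD n 0 := by
      intro y hy
      conv_rhs => rw [← hy.1]
      rw [getD_initSeg y hn]
    by_cases hk : σ.getD n 0 = k
    · exact Or.inl fun y hy => (this y hy).trans hk
    · exact Or.inr fun y hy h => hk ((this y hy).symm.trans h)
  · refine ⟨⟨fun τ => C.1 τ \ {k}, fun τ => (C.2 τ).sdiff (Set.finite_singleton k)⟩,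
      fun τ => Set.sdiff_subset, Or.inr fun y hy h => ?_⟩
    exact (hy.2 n hn).2 h

/-- The sets with pure decision form a σ-algebra that contains the subbasic clopen sets. -/
lemma pureDecision_of_measurableSet {B : Set (ℕ → ℕ)} (hB : MeasurableSet B) :
    PureDecision B := by
  let m : MeasurableSpace (ℕ → ℕ) :=
    { MeasurableSet' := PureDecision
      measurableSet_empty := fun σ C => ⟨C, le_rfl, Or.inr (by simp)⟩
      measurableSet_compl := fun _ h => h.compl
      measurableSet_iUnion := fun _ h => PureDecision.iUnion h }
  have hm : MeasurableSpace.pi ≤ m := by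
    refine iSup_le fun n => ?_
    rintro _ ⟨s, -, rfl⟩
    have : (fun y : ℕ → ℕ => y n) ⁻¹' s = ⋃ k ∈ s, {y | y n = k} := by
      ext y; simp
    rw [this]
    exact @MeasurableSet.biUnion _ _ m _ _ s.to_countable fun k _ => pureDecision_eval n k
  exact hm B hB

/-! ### Limits at the nodes -/

lemma exists_cone_agree {F : (ℕ → ℕ) → ℕ → Bool} (hF : ∀ k, PureDecision {y | F y k = true})
    (n : ℕ) (σ : List ℕ) (C : Thinning) :
    ∃ D ≤ C, ∀ y ∈ cone D σ, ∀ z ∈ cone D σ, ∀ k < n, F y k = F z k := by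
  induction n with
  | zero => exact ⟨C, le_rfl, by simp⟩
  | succ n ih =>
    obtain ⟨D, hD, h⟩ := ih
    obtain ⟨E, hE, h'⟩ := hF n σ D
    refine ⟨E, hE.trans hD, fun y hy z hz k hk => ?_⟩
    rcases Nat.lt_succ_iff_lt_or_eq.1 hk with hk | rfl
    · exact h y (cone_mono hE _ hy) z (cone_mono hE _ hz) k hk
    · rcases h' with h' | h'
      · exact (h' hy).trans (h' hz).symm
      · have h₁ : F y k ≠ true := h' hy
        have h₂ : F z k ≠ true := h' hz
        simp_all

lemma exists_infinite_subset_limit {A : Set ℕ} (hA : A.Infinite) (v : ℕ → ℕ → Bool) :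
    ∃ D ⊆ A, D.Infinite ∧ ∃ x : ℕ → Bool, ∀ k, {a ∈ D | v a k ≠ x k}.Finite := by
  let e := hA.natEmbedding
  obtain ⟨x, φ, hφ, hx⟩ := CompactSpace.tendsto_subseq fun n => v (e n)
  refine ⟨Set.range fun n => (e (φ n) : ℕ), ?_, ?_, x, fun k => ?_⟩
  · rintro _ ⟨n, rfl⟩
    exact (e (φ n)).2
  · exact Set.infinite_range_of_injective
      (Subtype.val_injective.comp (e.injective.comp hφ.injective))
  · have h : ∀ᶠ n in atTop, v (e (φ n)) k = x k :=
      (tendsto_pi_nhds.1 hx k).eventually_mem ((isOpen_discrete {x k}).mem_nhds rfl)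
    rw [← Nat.cofinite_eq_atTop, eventually_cofinite] at h
    refine (h.image fun n => (e (φ n) : ℕ)).subset ?_
    rintro _ ⟨⟨n, rfl⟩, hn⟩
    exact ⟨n, hn, rfl⟩

/-- Every function that satisfies pure decision has limits at all nodes of a Laver tree. -/
lemma exists_limits {F : (ℕ → ℕ) → ℕ → Bool} (hF : ∀ k, PureDecision {y | F y k = true}) :
    ∃ (D : Thinning) (x : List ℕ → ℕ → Bool),
      (∀ σ k, {a ∈ D.1 σ | ∃ y ∈ cone D (σ ++ [a]), F y k ≠ x σ k}.Finite) ∧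
      (∀ σ, ∀ y ∈ cone D σ, ∀ k < σ.sum + σ.length, F y k = x σ k) := by
  obtain ⟨E, -, hE⟩ := exists_fusion ⟨fun _ => Set.univ, fun _ => Set.infinite_univ⟩
    -- The sum settles bit `k` beyond `σ ++ [a]` as soon as `a > k`; the length makes the number of
    -- settled bits grow along every branch, even through entries `0`.
    (fun σ G => ∀ y ∈ cone G σ, ∀ z ∈ cone G σ, ∀ k < σ.sum + σ.length, F y k = F z k)
    (fun σ C _ => exists_cone_agree hF _ σ C)
  replace hE : ∀ σ, ∀ y ∈ cone E σ, ∀ z ∈ cone E σ, ∀ k < σ.sum + σ.length, F y k = F z k := by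
    intro σ
    obtain ⟨G, -, hG, hEG⟩ := hE σ
    exact fun y hy z hz => hG y (hEG hy) z (hEG hz)
  choose p hp using cone_nonempty E
  choose D hDE hD x hx using fun σ =>
    exists_infinite_subset_limit (E.2 σ) fun a => F (p (σ ++ [a]))
  let D' : Thinning := ⟨D, hD⟩
  have hle : D' ≤ E := hDE
  have hlim : ∀ σ k, {a ∈ D σ | ∃ y ∈ cone E (σ ++ [a]), F y k ≠ x σ k}.Finite := by
    intro σ k
    refine ((hx σ k).union (Set.finite_Iic k)).subset ?_
    rintro a ⟨ha, y, hy, hne⟩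
    rcases le_or_gt a k with h | h
    · exact Or.inr h
    · refine Or.inl ⟨ha, fun heq => hne ?_⟩
      rw [← heq]
      exact hE _ y hy _ (hp _) k (by simp; omega)
  refine ⟨D', x, fun σ k => (hlim σ k).subset ?_, fun σ y hy k hk => ?_⟩
  · rintro a ⟨ha, y, hy, hne⟩
    exact ⟨ha, y, cone_mono hle _ hy, hne⟩
  · obtain ⟨a, ha, hna⟩ := (hD σ).exists_notMem_finite (hlim σ k)
    have : F (p (σ ++ [a])) k = x σ k := by
      by_contra hne
      exact hna ⟨ha, _, hp _, hne⟩
    rw [← this]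
    exact hE σ y (cone_mono hle _ hy) _ (cone_append_subset (hDE σ ha) (hp _)) k hk

/-! ### Rank of the nodes and separation of levels -/

/-- The nodes from which a node in `P` is reached at stage `α` of the derivation. -/
def stage (D : Thinning) (P : List ℕ → Prop) (α : Ordinal.{0}) : Set (List ℕ) :=
  {σ | ¬ P σ → {a ∈ D.1 σ | ∃ β, ∃ _ : β < α, σ ++ [a] ∈ stage D P β}.Infinite}
termination_by α

lemma mem_stage {D : Thinning} {P : List ℕ → Prop} {α : Ordinal.{0}} {σ : List ℕ} :
    σ ∈ stage D P α ↔
      (¬ P σ → {a ∈ D.1 σ | ∃ β < α, σ ++ [a] ∈ stage D P β}.Infinite) := by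
  conv_lhs => rw [stage]
  simp only [exists_prop]
  rfl

/-- Either the nodes in `P` are avoided by the nodes of some Laver tree, or there is a rank
that can be made to decrease along a Laver tree until a node in `P` is reached. -/
lemma avoids_or_exists_rank (D : Thinning) (P : List ℕ → Prop) :
    (∃ U : Set (List ℕ), U.Nonempty ∧ ∀ σ ∈ U, ¬ P σ ∧ {a ∈ D.1 σ | σ ++ [a] ∈ U}.Infinite) ∨
    ∃ r : List ℕ → Ordinal.{0}, ∀ σ, ¬ P σ → {a ∈ D.1 σ | r (σ ++ [a]) < r σ}.Infinite := by
  by_cases h : ∀ σ, ∃ α, σ ∈ stage D P α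
  · right
    refine ⟨fun σ => sInf {α | σ ∈ stage D P α}, fun σ hσ => ?_⟩
    have hmem : σ ∈ stage D P (sInf {α | σ ∈ stage D P α}) := csInf_mem (h σ)
    refine (mem_stage.1 hmem hσ).mono ?_
    rintro a ⟨ha, β, hβ, hs⟩
    exact ⟨ha, (csInf_le' (by exact hs)).trans_lt hβ⟩
  · left
    push Not at h
    refine ⟨{σ | ∀ α, σ ∉ stage D P α}, h, fun σ hσ => ⟨fun hP => ?_, fun hfin => ?_⟩⟩
    · exact hσ 0 (mem_stage.2 fun h => absurd hP h)
    · choose! β hβ using fun a (ha : ¬ ∀ α, σ ++ [a] ∉ stage D P α) => not_forall_not.1 ha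
      -- If only finitely many successors stay outside all stages, the others have a common bound,
      -- and `σ` enters at the next stage.
      refine hσ (Order.succ (⨆ a, β a)) (mem_stage.2 fun _ => ?_)
      refine ((D.2 σ).sdiff hfin).mono ?_
      rintro a ⟨ha, hna⟩
      have hna' : ¬ ∀ α, σ ++ [a] ∉ stage D P α := fun h => hna ⟨ha, h⟩
      exact ⟨ha, β a, Order.lt_succ_of_le (Ordinal.le_iSup β a), hβ a hna'⟩

/-- Levels that are finite-to-one at every node of a countable family can be made globally
injective by shrinking the sets of successors. -/
lemma exists_thinning_injective (D : Thinning) (P : List ℕ → Prop) (l : List ℕ → ℕ → ℕ)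
    (h : ∀ σ, P σ → ∀ k, {a ∈ D.1 σ | l σ a = k}.Finite) :
    ∃ E ≤ D, (∀ σ, ¬ P σ → E.1 σ = D.1 σ) ∧
      ∀ σ τ a b, P σ → P τ → a ∈ E.1 σ → b ∈ E.1 τ → l σ a = l τ b → σ = τ ∧ a = b := by
  classical
  -- Bookkeeping: step `n` serves the node coded by its first component, so each node is served
  -- infinitely often. Each step serving a node in `P` uses a larger level than the earlier ones.
  let s : ℕ → List ℕ := fun n => Denumerable.ofNat (List ℕ) n.unpair.1
  obtain ⟨φ, hφ, hP⟩ := extraction_forall_of_frequently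
    (P := fun n k => P (s n) → ∃ a ∈ D.1 (s n), l (s n) a = k) (by
      intro n
      by_cases hn : P (s n)
      · have hinf : (l (s n) '' D.1 (s n)).Infinite := by
          intro hfin
          refine D.2 (s n) (hfin.of_finite_fibers _ fun k _ => (h (s n) hn k).subset ?_)
          rintro a ⟨ha, hk⟩
          exact ⟨ha, hk⟩
        refine (Nat.frequently_atTop_iff_infinite.2 hinf).mono ?_
        rintro k ⟨a, ha, rfl⟩ -
        exact ⟨a, ha, rfl⟩
      · exact Frequently.of_forall fun k h => absurd h hn)
  choose! g hgD hg using hP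
  have hs : ∀ σ m, s (Nat.pair (Encodable.encode σ) m) = σ := by
    intro σ m
    simp [s]
  have hgD' : ∀ σ m, P σ → g (Nat.pair (Encodable.encode σ) m) ∈ D.1 σ := by
    intro σ m hσ
    have := hgD (Nat.pair (Encodable.encode σ) m)
    rw [hs] at this
    exact this hσ
  have hg' : ∀ σ m, P σ → l σ (g (Nat.pair (Encodable.encode σ) m)) =
      φ (Nat.pair (Encodable.encode σ) m) := by
    intro σ m hσ
    have := hg (Nat.pair (Encodable.encode σ) m)
    rw [hs] at this
    exact this hσ
  refine ⟨⟨fun σ => if P σ then Set.range fun m => g (Nat.pair (Encodable.encode σ) m)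
    else D.1 σ, fun σ => ?_⟩, fun σ => ?_, fun σ hσ => if_neg hσ, ?_⟩
  · dsimp only
    split_ifs with hσ
    · refine Set.infinite_range_of_injective fun m m' hm => ?_
      have := congrArg (l σ) hm
      rw [hg' σ m hσ, hg' σ m' hσ] at this
      exact (Nat.pair_eq_pair.1 (hφ.injective this)).2
    · exact D.2 σ
  · dsimp only
    split_ifs with hσ
    · rintro _ ⟨m, rfl⟩
      exact hgD' σ m hσ
    · exact le_rfl
  · intro σ τ a b hσ hτ ha hb hl
    simp only [if_pos hσ, if_pos hτ] at ha hb
    obtain ⟨m, rfl⟩ := ha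
    obtain ⟨m', rfl⟩ := hb
    rw [hg' σ m hσ, hg' τ m' hτ] at hl
    have := Nat.pair_eq_pair.1 (hφ.injective hl)
    have hστ : σ = τ := Encodable.encode_injective this.1
    exact ⟨hστ, by rw [hστ, this.2]⟩

/-! ### One-to-one or constant for Laver forcing on `ω` -/

/-- Laver forcing has the one-to-one or constant property. -/
theorem exists_cone_injOn_or_const {F : (ℕ → ℕ) → ℕ → Bool}
    (hF : ∀ k, PureDecision {y | F y k = true}) :
    ∃ (C : Thinning) (σ : List ℕ),
      Set.InjOn F (cone C σ) ∨ ∃ c, ∀ y ∈ cone C σ, F y = c := by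
  classical
  obtain ⟨D, x, hlim, hx⟩ := exists_limits hF
  have hxlim : ∀ σ k, {a ∈ D.1 σ | x (σ ++ [a]) k ≠ x σ k}.Finite := by
    intro σ k
    refine ((hlim σ k).union (Set.finite_Iic k)).subset ?_
    rintro a ⟨ha, hne⟩
    rcases le_or_gt a k with h | h
    · exact Or.inr h
    · obtain ⟨y, hy⟩ := cone_nonempty D (σ ++ [a])
      refine Or.inl ⟨ha, y, hy, ?_⟩
      rwa [hx _ y hy k (by simp; omega)]
  let E : Thinning := ⟨fun σ => if {a ∈ D.1 σ | x (σ ++ [a]) = x σ}.Infinite then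
      {a ∈ D.1 σ | x (σ ++ [a]) = x σ} else {a ∈ D.1 σ | x (σ ++ [a]) ≠ x σ}, fun σ => by
    dsimp only
    split_ifs with h
    · exact h
    · refine ((D.2 σ).sdiff (Set.not_infinite.1 h)).mono ?_
      rintro a ⟨ha, hna⟩
      exact ⟨ha, fun heq => hna ⟨ha, heq⟩⟩⟩
  let P : List ℕ → Prop := fun σ => ¬ {a ∈ D.1 σ | x (σ ++ [a]) = x σ}.Infinite
  have hED : E ≤ D := by
    intro σ
    dsimp only [E]
    split_ifs
    exacts [fun a ha => ha.1, fun a ha => ha.1]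
  have hconst : ∀ σ, ¬ P σ → ∀ a ∈ E.1 σ, x (σ ++ [a]) = x σ := by
    intro σ hσ a ha
    simp only [E, if_pos (not_not.1 hσ)] at ha
    exact ha.2
  have hsplit : ∀ σ, P σ → ∀ a ∈ E.1 σ, x (σ ++ [a]) ≠ x σ := by
    intro σ hσ a ha
    simp only [E, if_neg hσ] at ha
    exact ha.2
  rcases avoids_or_exists_rank E P with ⟨U, ⟨σ, hσ⟩, hU⟩ | ⟨r, hr⟩
  · let C : Thinning := ⟨fun τ => if τ ∈ U then {a ∈ E.1 τ | τ ++ [a] ∈ U} else E.1 τ, fun τ => by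
      dsimp only
      split_ifs with hτ
      exacts [(hU τ hτ).2, E.2 τ]⟩
    have hCE : C ≤ E := by
      intro τ
      dsimp only [C]
      split_ifs
      exacts [fun a ha => ha.1, le_rfl]
    refine ⟨C, σ, Or.inr ⟨x σ, fun y hy => ?_⟩⟩
    have key : ∀ n, initSeg y (σ.length + n) ∈ U ∧ x (initSeg y (σ.length + n)) = x σ := by
      intro n
      induction n with
      | zero => rw [add_zero, hy.1]; exact ⟨hσ, rfl⟩
      | succ n ih =>
        have ha := hy.2 (σ.length + n) (by omega)
        simp only [C, if_pos ih.1] at ha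
        rw [← add_assoc, initSeg_succ]
        exact ⟨ha.2, (hconst _ (hU _ ih.1).1 _ ha.1).trans ih.2⟩
    -- The node of length `σ.length + k + 1` already settles bit `k`.
    funext k
    rw [← (key (k + 1)).2]
    exact hx _ y (cone_mono (hCE.trans hED) _ (mem_cone_initSeg hy (by omega))) k
      (by simp; omega)
  · let R : Thinning := ⟨fun σ => if P σ then E.1 σ else {a ∈ E.1 σ | r (σ ++ [a]) < r σ},
      fun σ => by
        dsimp only
        split_ifs with hσ
        exacts [E.2 σ, hr σ hσ]⟩
    have hRE : R ≤ E := by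
      intro τ
      dsimp only [R]
      split_ifs
      exacts [le_rfl, fun a ha => ha.1]
    have hRr : ∀ σ, ¬ P σ → ∀ a ∈ R.1 σ, r (σ ++ [a]) < r σ := by
      intro σ hσ a ha
      simp only [R, if_neg hσ] at ha
      exact ha.2
    let l : List ℕ → ℕ → ℕ := fun σ a => sInf {k | x (σ ++ [a]) k ≠ x σ k}
    have hl : ∀ σ a, x (σ ++ [a]) ≠ x σ →
        x (σ ++ [a]) (l σ a) ≠ x σ (l σ a) ∧ ∀ k < l σ a, x (σ ++ [a]) k = x σ k := by
      intro σ a hne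
      exact ⟨Nat.sInf_mem (Function.ne_iff.1 hne), fun k hk => not_not.1 (Nat.notMem_of_lt_sInf hk)⟩
    obtain ⟨I, hIR, -, hI⟩ := exists_thinning_injective R P l (by
      intro σ hσ k
      refine (hxlim σ k).subset ?_
      rintro a ⟨ha, rfl⟩
      exact ⟨hED σ (hRE σ ha), (hl σ a (hsplit σ hσ a (hRE σ ha))).1⟩)
    have hID : I ≤ D := hIR.trans (hRE.trans hED)
    -- `M σ` is the level attached to the step that leads to `σ`. Below, `K` discards the finitely
    -- many successors of `σ` beyond which `F` could leave `x σ` at or below `M σ`. The value at the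
    -- root is arbitrary and harmless.
    let M : List ℕ → ℕ := fun σ => l σ.dropLast (σ.getLastD 0)
    let K : Thinning := ⟨fun σ => I.1 σ \ ⋃ k ∈ Set.Iic (M σ),
        {a ∈ D.1 σ | ∃ y ∈ cone D (σ ++ [a]), F y k ≠ x σ k}, fun σ =>
      (I.2 σ).sdiff ((Set.finite_Iic _).biUnion fun k _ => hlim σ k)⟩
    have hKI : K ≤ I := fun σ => Set.sdiff_subset
    have hfirst : ∀ y ∈ cone K [], ∀ m, P (initSeg y m) →
        F y (l (initSeg y m) (y m)) ≠ x (initSeg y m) (l (initSeg y m) (y m)) ∧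
        ∀ k < l (initSeg y m) (y m), F y k = x (initSeg y m) k := by
      intro y hy m hm
      have hne := hsplit _ hm (y m) (hRE _ (hIR _ (hKI _ (hy.2 m (by simp)))))
      have hagree : ∀ k ≤ l (initSeg y m) (y m), F y k = x (initSeg y m ++ [y m]) k := by
        intro k hk
        by_contra hcon
        have hm1 := hy.2 (m + 1) (by simp)
        refine hm1.2 (Set.mem_biUnion (x := k) ?_ ⟨hID _ hm1.1, y, ?_, ?_⟩)
        · simpa [M, initSeg_succ] using hk
        · rw [← initSeg_succ]
          exact cone_mono (hKI.trans hID) _ (mem_cone_initSeg hy (by simp))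
        · rwa [initSeg_succ]
      obtain ⟨h₁, h₂⟩ := hl _ _ hne
      exact ⟨by rwa [hagree _ le_rfl], fun k hk => by rw [hagree k hk.le, h₂ k hk]⟩
    have hreach : ∀ y ∈ cone K [], ∀ α n, r (initSeg y n) = α →
        ∃ m, n ≤ m ∧ P (initSeg y m) ∧ x (initSeg y m) = x (initSeg y n) := by
      intro y hy α
      induction α using WellFoundedLT.induction with
      | _ α ih =>
        rintro n rfl
        by_cases hn : P (initSeg y n)
        · exact ⟨n, le_rfl, hn, rfl⟩
        · have ha := hIR _ (hKI _ (hy.2 n (by simp)))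
          have hlt := hRr _ hn _ ha
          rw [← initSeg_succ] at hlt
          obtain ⟨m, hm, hPm, hxm⟩ := ih _ hlt (n + 1) rfl
          refine ⟨m, by omega, hPm, hxm.trans ?_⟩
          rw [initSeg_succ]
          exact hconst _ hn _ (hRE _ ha)
    refine ⟨K, [], Or.inl fun y hy z hz hyz => ?_⟩
    by_contra hne
    have hex := Function.ne_iff.1 hne
    set n := Nat.find hex
    have hn : y n ≠ z n := Nat.find_spec hex
    have hseg : initSeg y n = initSeg z n :=
      initSeg_eq_iff.2 fun k hk => not_not.1 (Nat.find_min hex hk)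
    obtain ⟨m, hnm, hPm, hxm⟩ := hreach y hy _ n rfl
    obtain ⟨m', hnm', hPm', hxm'⟩ := hreach z hz _ n rfl
    have hxx : x (initSeg y m) = x (initSeg z m') := by rw [hxm, hxm', hseg]
    obtain ⟨h₁, h₂⟩ := hfirst y hy m hPm
    obtain ⟨h₁', h₂'⟩ := hfirst z hz m' hPm'
    rw [hxx, hyz] at h₁ h₂
    -- Both sides are the first place where the common value of `F` leaves the common limit.
    have hll : l (initSeg y m) (y m) = l (initSeg z m') (z m') := by
      rcases lt_trichotomy (l (initSeg y m) (y m)) (l (initSeg z m') (z m')) with h | h | h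
      · exact absurd (h₂' _ h) h₁
      · exact h
      · exact absurd (h₂ _ h) h₁'
    obtain ⟨hs, hv⟩ := hI _ _ _ _ hPm hPm' (hKI _ (hy.2 m (by simp)))
      (hKI _ (hz.2 m' (by simp))) hll
    have hmm : m = m' := by simpa using congrArg List.length hs
    subst hmm
    rcases hnm.eq_or_lt with rfl | hlt
    · exact hn hv
    · exact hn (initSeg_eq_iff.1 hs n hlt)

/-! ### Coding pairs of Laver choices as points of `ω × ω` -/

lemma mem_positive_finTimesFin {X : Set (ℕ × ℕ)} :
    X ∈ positive finTimesFin ↔ {n : ℕ | {m : ℕ | (n, m) ∈ X}.Infinite}.Infinite :=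
  Iff.rfl

/-- A positive set for `fin × fin` contains an injective copy of `ω × ω`, column by column. -/
lemma exists_columns {X : Set (ℕ × ℕ)} (hX : X ∈ positive finTimesFin) :
    ∃ (c : ℕ → ℕ) (d : ℕ → ℕ → ℕ), c.Injective ∧ (∀ i, (d i).Injective) ∧
      ∀ i j, (c i, d i j) ∈ X := by
  rw [mem_positive_finTimesFin] at hX
  let e := hX.natEmbedding
  let g : ∀ i, ℕ ↪ {m : ℕ | ((e i : ℕ), m) ∈ X} := fun i => (e i).2.natEmbedding
  exact ⟨fun i => e i, fun i j => g i j, Subtype.val_injective.comp e.injective,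
    fun i => Subtype.val_injective.comp (g i).injective, fun i j => (g i j).2⟩

section Coding

variable {A : Type*} (s : List A) (φ : List A → ℕ × ℕ → A)

/-- The sequence starting with `s` whose later values are read off from consecutive pairs
of values of `y` by means of `φ`. -/
def code (y : ℕ → ℕ) : ℕ → A :=
  branchFrom s fun τ => φ τ (y (2 * (τ.length - s.length)), y (2 * (τ.length - s.length) + 1))

variable {s φ}

lemma initSeg_code (y : ℕ → ℕ) : initSeg (code s φ y) s.length = s := initSeg_branchFrom _ _

lemma code_eq (y : ℕ → ℕ) (n : ℕ) : code s φ y (s.length + n) =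
    φ (initSeg (code s φ y) (s.length + n)) (y (2 * n), y (2 * n + 1)) := by
  conv_lhs => rw [code, branchFrom_eq _ _ (Nat.le_add_right _ _)]
  simp [code]

/-- Each entry beyond `s` uses one fresh pair of values, recoverable because `φ` is injective at the
node reached. Injectivity and continuity of the coding, and closedness of the images, rest on this.
-/
lemma initSeg_code_eq_iff (hφ : ∀ τ, (φ τ).Injective) {y z : ℕ → ℕ} {n : ℕ} :
    initSeg (code s φ y) (s.length + n) = initSeg (code s φ z) (s.length + n) ↔
      initSeg y (2 * n) = initSeg z (2 * n) := by
  induction n with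
  | zero => simp [initSeg_code]
  | succ n ih =>
    have h2 : 2 * (n + 1) = 2 * n + 1 + 1 := by ring
    rw [h2, ← add_assoc, initSeg_succ, initSeg_succ, initSeg_succ, initSeg_succ, initSeg_succ,
      initSeg_succ, code_eq, code_eq]
    constructor
    · intro h
      obtain ⟨h₁, h₂⟩ := List.append_inj' h rfl
      rw [h₁] at h₂
      have := hφ _ (List.singleton_inj.1 h₂)
      simp only [Prod.mk.injEq] at this
      rw [ih.1 h₁, this.1, this.2]
    · intro h
      obtain ⟨h₁, h₂⟩ := List.append_inj' h rfl
      obtain ⟨h₁, h₃⟩ := List.append_inj' h₁ rfl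
      rw [ih.2 h₁, List.singleton_inj.1 h₂, List.singleton_inj.1 h₃]

lemma continuous_code [TopologicalSpace A] (hφ : ∀ τ, (φ τ).Injective) :
    Continuous (code s φ) := by
  refine continuous_pi fun k => IsLocallyConstant.continuous ?_
  rw [IsLocallyConstant.iff_eventually_eq]
  intro y
  have h : ∀ᶠ z in 𝓝 y, ∀ i ∈ Finset.range (2 * (k + 1)), z i = y i := by
    rw [Filter.eventually_all_finset]
    intro i _
    exact (continuous_apply i).continuousAt.eventually_mem
      ((isOpen_discrete {y i}).mem_nhds rfl)
  filter_upwards [h] with z hz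
  have := (initSeg_code_eq_iff (s := s) hφ).2
    (initSeg_eq_iff.2 fun i hi => hz i (Finset.mem_range.2 hi))
  exact initSeg_eq_iff.1 this k (by omega)

/-- The images of the branches of a Laver tree on `ω` under `code` are closed. -/
lemma exists_code_eq (hφ : ∀ τ, (φ τ).Injective) {C : Thinning} {σ : List ℕ} {x : ℕ → A}
    (hx : ∀ n, ∃ y ∈ cone C σ, initSeg x n = initSeg (code s φ y) n) :
    ∃ y ∈ cone C σ, code s φ y = x := by
  choose p hp hpx using hx
  have hagree : ∀ n m, s.length + n ≤ m →
      initSeg (p (s.length + n)) (2 * n) = initSeg (p m) (2 * n) := by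
    intro n m hm
    rw [← initSeg_code_eq_iff (s := s) hφ, ← hpx]
    exact initSeg_eq_of_le (hpx m) hm
  -- The approximation with `k + 1` entries beyond `s` fixes `2 * (k + 1)` values of `y`, in
  -- particular the one at `k`.
  let y : ℕ → ℕ := fun k => p (s.length + (k + 1)) k
  have hy : ∀ n m, s.length + n ≤ m → initSeg y n = initSeg (p m) n := by
    intro n m hm
    refine initSeg_eq_iff.2 fun k hk => ?_
    exact initSeg_eq_iff.1 (hagree (k + 1) m (by omega)) k (by omega)
  refine ⟨y, ⟨?_, fun n hn => ?_⟩, ?_⟩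
  · rw [hy _ _ le_rfl]
    exact (hp _).1
  · have h := hy (n + 1) _ le_rfl
    rw [initSeg_eq_iff.1 h n (by omega), initSeg_eq_of_le h (Nat.le_succ n)]
    exact (hp _).2 n hn
  · funext k
    have h₁ := (initSeg_code_eq_iff (s := s) hφ).2 (hy (2 * (k + 1)) _ le_rfl)
    have h₂ := initSeg_eq_of_le h₁ (m := k + 1) (by omega)
    rw [← initSeg_eq_of_le (hpx _) (by omega)] at h₂
    exact initSeg_eq_iff.1 h₂ k (by omega)

/-- The tree of the initial segments of the sequences coded by the branches in `cone C σ`. -/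
def codeTree (s : List A) (φ : List A → ℕ × ℕ → A) (C : Thinning) (σ : List ℕ) : tree A :=
  ⟨{τ | ∃ y ∈ cone C σ, ∃ n, τ = initSeg (code s φ y) n}, by
    rintro τ a ⟨y, hy, n, h⟩
    refine ⟨y, hy, τ.length, ?_⟩
    exact (initSeg_of_prefix (h ▸ List.prefix_append τ [a])).symm⟩

lemma mem_codeTree {C : Thinning} {σ : List ℕ} {τ : List A} :
    τ ∈ codeTree s φ C σ ↔ ∃ y ∈ cone C σ, ∃ n, τ = initSeg (code s φ y) n :=
  Iff.rfl

lemma exists_code_eq_of_mem_branches (hφ : ∀ τ, (φ τ).Injective) {C : Thinning} {σ : List ℕ}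
    {x : ℕ → A} (hx : x ∈ branches (codeTree s φ C σ)) : ∃ y ∈ cone C σ, code s φ y = x := by
  refine exists_code_eq hφ fun n => ?_
  obtain ⟨y, hy, m, hm⟩ := mem_codeTree.1 (hx n)
  change initSeg x n = _ at hm
  have hmn : n = m := by simpa using congrArg List.length hm
  subst hmn
  exact ⟨y, hy, hm⟩

/-- Nodes of even length of a Laver tree on `ω` have a full column structure in `codeTree`. -/
lemma mem_succ_codeTree (hφ : ∀ τ, (φ τ).Injective) {C : Thinning} {σ : List ℕ} {y : ℕ → ℕ}
    (hy : y ∈ cone C σ) {n : ℕ} (hn : σ.length ≤ 2 * n) {i j : ℕ}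
    (hi : i ∈ C.1 (initSeg y (2 * n))) (hj : j ∈ C.1 (initSeg y (2 * n) ++ [i])) :
    φ (initSeg (code s φ y) (s.length + n)) (i, j) ∈
      succ (codeTree s φ C σ) (initSeg (code s φ y) (s.length + n)) := by
  obtain ⟨z, hz⟩ := cone_nonempty C (initSeg y (2 * n) ++ [i] ++ [j])
  have hzy := cone_append_subset hi (cone_append_subset hj hz)
  have hz₁ := initSeg_length_append.1 hz.1
  have hz₂ := initSeg_length_append.1 hz₁.1
  have hseg : initSeg z (2 * n) = initSeg y (2 * n) := by simpa using hz₂.1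
  have hzi : z (2 * n) = i := by simpa using hz₂.2
  have hzj : z (2 * n + 1) = j := by simpa using hz₁.2
  have hcode := (initSeg_code_eq_iff (s := s) hφ).2 hseg
  refine ⟨z, cone_initSeg_subset hy hn hzy, s.length + n + 1, ?_⟩
  rw [initSeg_succ, code_eq, hcode, hzi, hzj]

end Coding

/-! ### Transfer to `fin × fin` -/

lemma measurable_bool_apply {X : Type*} [TopologicalSpace X] {f : X → ℕ → Bool}
    (hf : @Measurable _ _ (borel X) (borel (ℕ → Bool)) f) (k : ℕ) :
    @MeasurableSet _ (borel X) {x | f x k = true} := by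
  have h : IsOpen ((fun c : ℕ → Bool => c k) ⁻¹' {true}) :=
    (isOpen_discrete _).preimage (continuous_apply k)
  exact hf (MeasurableSpace.measurableSet_generateFrom h)

theorem oneToOneOrConstant_finTimesFin : OneToOneOrConstant finTimesFin := by
  classical
  rintro T ⟨s, hs⟩ f hf
  have hφ : ∀ τ : List (ℕ × ℕ), ∃ (c : ℕ → ℕ) (d : ℕ → ℕ → ℕ), c.Injective ∧
      (∀ i, (d i).Injective) ∧ (τ ∈ T → s <+: τ → ∀ i j, (c i, d i j) ∈ succ T τ) := by
    intro τ
    by_cases h : τ ∈ T ∧ s <+: τ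
    · obtain ⟨c, d, hc, hd, hcd⟩ := exists_columns (hs.succ_positive τ h.1 h.2)
      exact ⟨c, d, hc, hd, fun _ _ => hcd⟩
    -- Dummy values off the relevant nodes keep `φ` injective everywhere.
    · exact ⟨id, fun _ => id, Function.injective_id, fun _ => Function.injective_id,
        fun h₁ h₂ => absurd ⟨h₁, h₂⟩ h⟩
  choose c d hc hd hcd using hφ
  let φ : List (ℕ × ℕ) → ℕ × ℕ → ℕ × ℕ := fun τ p => (c τ p.1, d τ p.1 p.2)
  have hφ : ∀ τ, (φ τ).Injective := by
    rintro τ ⟨i, j⟩ ⟨i', j'⟩ h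
    obtain ⟨h₁, h₂⟩ := Prod.mk.inj h
    obtain rfl := hc τ h₁
    obtain rfl := hd τ i h₂
    rfl
  have hmem : ∀ y n, initSeg (code s φ y) (s.length + n) ∈ T := by
    intro y n
    induction n with
    | zero => rw [add_zero, initSeg_code]; exact hs.mem
    | succ n ih =>
      have hpre : s <+: initSeg (code s φ y) (s.length + n) := by
        conv_lhs => rw [← initSeg_code (s := s) (φ := φ) y]
        exact initSeg_prefix _ (by omega)
      rw [← add_assoc, initSeg_succ, code_eq]
      exact hcd _ ih hpre _ _
  have hbr : ∀ y, code s φ y ∈ branches T := fun y n =>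
    Tree.mem_of_prefix (initSeg_prefix _ (Nat.le_add_left n s.length)) (hmem y n)
  let g : (ℕ → ℕ) → branches T := fun y => ⟨code s φ y, hbr y⟩
  have hg : Continuous g := (continuous_code hφ).subtype_mk _
  have hF : ∀ k, PureDecision {y | f (g y) k = true} := by
    intro k
    refine pureDecision_of_measurableSet ?_
    rw [BorelSpace.measurable_eq (α := ℕ → ℕ)]
    exact hg.borel_measurable (measurable_bool_apply hf k)
  obtain ⟨C, σ, hC⟩ := exists_cone_injOn_or_const (F := fun y => f (g y)) hF
  obtain ⟨y₀, hy₀⟩ := cone_nonempty C σ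
  have hlen : σ.length ≤ 2 * σ.length := by omega
  -- Lengthening the stem to even length makes it end between two pairs, so it codes a node of the
  -- new tree.
  set ρ := initSeg y₀ (2 * σ.length) with hρ
  have hsub : cone C ρ ⊆ cone C σ := cone_initSeg_subset hy₀ hlen
  have hρlen : ρ.length = 2 * σ.length := by simp [hρ]
  have hstem : ∀ y ∈ cone C ρ, initSeg (code s φ y) (s.length + σ.length) =
      initSeg (code s φ y₀) (s.length + σ.length) := by
    intro y hy
    rw [initSeg_code_eq_iff hφ, ← hρ, ← hy.1, hρlen]
  have hy₀ρ : y₀ ∈ cone C ρ := mem_cone_initSeg hy₀ hlen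
  refine ⟨codeTree s φ C ρ, ⟨initSeg (code s φ y₀) (s.length + σ.length), ?_, ?_, ?_⟩, ?_, ?_⟩
  · exact ⟨y₀, hy₀ρ, _, rfl⟩
  · rintro _ ⟨y, hy, n, rfl⟩
    rw [← hstem y hy]
    rcases le_total n (s.length + σ.length) with h | h
    · exact Or.inl (initSeg_prefix _ h)
    · exact Or.inr (initSeg_prefix _ h)
  · rintro _ ⟨y, hy, n, rfl⟩ hpre
    have hn : s.length + σ.length ≤ n := by simpa using hpre.length_le
    obtain ⟨m, rfl⟩ := Nat.exists_eq_add_of_le ((Nat.le_add_right _ _).trans hn)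
    have hm : ρ.length ≤ 2 * m := by omega
    set τ := initSeg (code s φ y) (s.length + m) with hτ
    rw [mem_positive_finTimesFin]
    refine ((C.2 (initSeg y (2 * m))).image (hc τ).injOn).mono ?_
    rintro _ ⟨i, hi, rfl⟩
    refine ((C.2 (initSeg y (2 * m) ++ [i])).image (hd τ i).injOn).mono ?_
    rintro _ ⟨j, hj, rfl⟩
    exact mem_succ_codeTree hφ hy hm hi hj
  · rintro _ ⟨y, -, n, rfl⟩
    exact hbr y n
  · have hx : ∀ x : branches T, (x : ℕ → ℕ × ℕ) ∈ branches (codeTree s φ C ρ) →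
        ∃ y ∈ cone C σ, g y = x := by
      intro x hx
      obtain ⟨y, hy, h⟩ := exists_code_eq_of_mem_branches hφ hx
      exact ⟨y, hsub hy, Subtype.ext h⟩
    refine hC.imp (fun hinj => ?_) ?_
    · intro x hxS x' hxS' h
      obtain ⟨y, hy, rfl⟩ := hx x hxS
      obtain ⟨z, hz, rfl⟩ := hx x' hxS'
      rw [hinj hy hz h]
    · rintro ⟨v, hv⟩
      refine ⟨v, fun x hxS => ?_⟩
      obtain ⟨y, hy, rfl⟩ := hx x hxS
      exact hv y hy

end LaverCoideal

theorem mainTheorem8 : LaverCoideal.OneToOneOrConstant LaverCoideal.finTimesFin := by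
  exact LaverCoideal.oneToOneOrConstant_finTimesFin
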